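/- Consider a static game of complete information with players $i=1,\dots,I$, action sets $\mathcal Y_i=\{0,1\}$, action profiles $\mathcal Y=\{0,1\}^I$, a finite set $\mathcal X$ of covariate values, and a parameter set $\Theta\subseteq\mathbb R^d$. Player $i$'s payoff is $u_i(y_i,y_{-i},x,\xi_i;\theta)=y_i\,(w_i(y_{-i},x;\theta)+\xi_i)$ with arbitrary known real-valued functions $w_i$, where $\xi_1,\dots,\xi_I$ are independent and standard logistic. Let $F(z)=1/(1+e^{-z})$, $F(-\infty)=0$, $F(+\infty)=1$. Let $G(\xi\mid x;\theta)\subseteq\mathcal Y$ be the (possibly empty) set of pure strategy Nash equilibria, and for $A\subseteq\mathcal Y$ put $$\mathcal L(A\mid x;\theta)=\Pr\{\xi: G(\xi\mid x;\theta)\cap A\neq\emptyset\},\qquad \mathcal R(A\mid x;\theta)=\Pr\{\xi: A\subseteq G(\xi\mid x;\theta)\}.$$ Let $l_i(y,x,\theta)=-w_i(y_{-i},x;\theta)$ and $r_i(y,x,\theta)=+\infty$ if $y_i=1$, and $l_i(y,x,\theta)=-\infty$ and $r_i(y,x,\theta)=-w_i(y_{-i},x;\theta)$ if $y_i=0$.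 Let $\phi(\cdot\mid x)$, $x\in\mathcal X$, be probability vectors on $\mathcal Y$ (the conditional choice probabilities), and write $\phi(A\mid x)=\sum_{y\in A}\phi(y\mid x)$. The sharp identified set $\Theta_I^{\mathrm{sharp}}$ is the set of $\theta\in\Theta$ such that for every $x\in\mathcal X$ there is an equilibrium selection rule generating $\phi(\cdot\mid x)$: measurable functions $\xi\mapsto\sigma(y\mid\xi)$, $y\in\mathcal Y$, such that for almost every $\xi$ the vector $\sigma(\cdot\mid\xi)$ is a probability vector on $\mathcal Y$ that vanishes outside $G(\xi\mid x;\theta)$, and $\phi(y\mid x)=\mathbb E[\sigma(y\mid\xi)]$ for all $y\in\mathcal Y$. **Theorem.** For every $A\subseteq\mathcal Y$, $x\in\mathcal X$ and $\theta\in\Theta$, $$\mathcal R(A\mid x;\theta)=\prod_{i=1}^{I}\max\Bigl\{0,\;F\bigl(\min_{y\in A}r_i(y,x,\theta)\bigr)-F\bigl(\max_{y\in A}l_i(y,x,\theta)\bigr)\Bigr\},$$ (for $A=\emptyset$ the minimum is $+\infty$ and the maximum is $-\infty$) and $$\mathcal L(A\mid x;\theta)=\sum_{\emptyset\neq B\subseteq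 A}(-1)^{|B|+1}\prod_{i=1}^{I}\max\Bigl\{0,\;F\bigl(\min_{y\in B}r_i(y,x,\theta)\bigr)-F\bigl(\max_{y\in B}l_i(y,x,\theta)\bigr)\Bigr\}.$$ Consequently the sharp identified set is characterized by finitely many closed-form inequalities, one for each pair $(x,A)$ in the finite set $\mathcal X\times 2^{\mathcal Y}$: $$\Theta_I^{\mathrm{sharp}}=\Bigl\{\theta\in\Theta:\ \phi(A\mid x)\le\sum_{\emptyset\neq B\subseteq A}(-1)^{|B|+1}\prod_{i=1}^{I}\max\bigl\{0,\,F(\min_{y\in B}r_i(y,x,\theta))-F(\max_{y\in B}l_i(y,x,\theta))\bigr\}\quad\forall A\subseteq\mathcal Y,\ x\in\mathcal X\Bigr\}.$$ -/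

import Mathlib

open MeasureTheory

namespace BinaryGame

/-- The standard logistic distribution on `ℝ`, with density `e^{-z} / (1 + e^{-z})^2`. -/
noncomputable def logistic : Measure ℝ :=
  volume.withDensity fun z => ENNReal.ofReal (Real.exp (-z) / (1 + Real.exp (-z)) ^ 2)

/-- The function `F(z) = 1 / (1 + e^{-z})`, extended by `F(-∞) = 0` and `F(+∞) = 1`. -/
noncomputable def F (z : EReal) : ℝ :=
  if z = ⊥ then 0 else if z = ⊤ then 1 else 1 / (1 + Real.exp (-z.toReal))

/-- Action profiles of `I` players with action sets `{0, 1}`. -/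
abbrev Profile (I : ℕ) : Type := Fin I → Fin 2

/-- Action profiles of the opponents of player `i`. -/
abbrev OppProfile (I : ℕ) (i : Fin I) : Type := {j : Fin I // j ≠ i} → Fin 2

/-- The profile `y_{-i}` of the actions of `i`'s opponents. -/
def opp {I : ℕ} (i : Fin I) (y : Profile I) : OppProfile I i := fun j => y j

/-- The joint law of the payoff shocks `ξ = (ξ_1, …, ξ_I)`, independent and standard logistic. -/
noncomputable def shockLaw (I : ℕ) : Measure (Fin I → ℝ) :=
  Measure.pi fun _ => logistic

/-- The functions `w_i(y_{-i}, x; θ)`, for all players `i`. -/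
abbrev PayoffIndex (I d : ℕ) (X : Type*) : Type _ :=
  (i : Fin I) → OppProfile I i → X → EuclideanSpace ℝ (Fin d) → ℝ

variable {I d : ℕ} {X : Type*}

/-- The payoff `u_i(y_i, y_{-i}, x, ξ_i; θ) = y_i (w_i(y_{-i}, x; θ) + ξ_i)`. -/
noncomputable def payoff (w : PayoffIndex I d X) (i : Fin I) (y : Profile I) (x : X) (ξi : ℝ)
    (θ : EuclideanSpace ℝ (Fin d)) : ℝ :=
  ((y i : ℕ) : ℝ) * (w i (opp i y) x θ + ξi)

/-- `G(ξ | x; θ)`: the set of pure strategy Nash equilibria. -/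
def G (w : PayoffIndex I d X) (ξ : Fin I → ℝ) (x : X) (θ : EuclideanSpace ℝ (Fin d)) :
    Set (Profile I) :=
  {y | ∀ (i : Fin I) (a : Fin 2),
    payoff w i (Function.update y i a) x (ξ i) θ ≤ payoff w i y x (ξ i) θ}

/-- The generalized likelihood `𝓛(A | x; θ) = Pr{ξ : G(ξ | x; θ) ∩ A ≠ ∅}`. -/
noncomputable def L (w : PayoffIndex I d X) (A : Finset (Profile I)) (x : X)
    (θ : EuclideanSpace ℝ (Fin d)) : ℝ :=
  (shockLaw I).real {ξ | (G w ξ x θ ∩ (A : Set (Profile I))).Nonempty}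

/-- `𝓡(A | x; θ) = Pr{ξ : A ⊆ G(ξ | x; θ)}`. -/
noncomputable def R (w : PayoffIndex I d X) (A : Finset (Profile I)) (x : X)
    (θ : EuclideanSpace ℝ (Fin d)) : ℝ :=
  (shockLaw I).real {ξ | (A : Set (Profile I)) ⊆ G w ξ x θ}

/-- An equilibrium selection rule at `(x, θ)`: `sel ξ y` is the probability that `y` is played when
the shocks are `ξ`. Almost surely, `sel ξ` is a probability vector on `G(ξ | x; θ)`; there is
no other restriction on it. -/
structure IsSelectionRule (w : PayoffIndex I d X) (x : X) (θ : EuclideanSpace ℝ (Fin d))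
    (sel : (Fin I → ℝ) → Profile I → ℝ) : Prop where
  measurable : ∀ y, Measurable fun ξ => sel ξ y
  nonneg : ∀ᵐ ξ ∂shockLaw I, ∀ y, 0 ≤ sel ξ y
  sum_eq_one : ∀ᵐ ξ ∂shockLaw I, ∑ y, sel ξ y = 1
  equilibrium : ∀ᵐ ξ ∂shockLaw I, ∀ y, y ∉ G w ξ x θ → sel ξ y = 0

/-- The sharp identified set for the conditional choice probabilities `φ x y = φ(y | x)`: the
parameters in `Θ` at which, for every `x`, the distribution `φ(· | x)` is generated by
pure strategy Nash equilibria under some equilibrium selection rule. -/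
def sharpSet (w : PayoffIndex I d X) (Θ : Set (EuclideanSpace ℝ (Fin d)))
    (φ : X → Profile I → ℝ) : Set (EuclideanSpace ℝ (Fin d)) :=
  {θ | θ ∈ Θ ∧ ∀ x, ∃ sel : (Fin I → ℝ) → Profile I → ℝ, IsSelectionRule w x θ sel ∧
    ∀ y, φ x y = ∫ ξ, sel ξ y ∂shockLaw I}

/-- The left end point `l_i(y, x, θ)`: `-w_i(y_{-i}, x; θ)` if `y_i = 1`, and `-∞` if `y_i = 0`. -/
noncomputable def l (w : PayoffIndex I d X) (i : Fin I) (y : Profile I) (x : X)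
    (θ : EuclideanSpace ℝ (Fin d)) : EReal :=
  if y i = 1 then ((-w i (opp i y) x θ : ℝ) : EReal) else ⊥

/-- The right end point `r_i(y, x, θ)`: `+∞` if `y_i = 1`, and `-w_i(y_{-i}, x; θ)` if `y_i = 0`. -/
noncomputable def r (w : PayoffIndex I d X) (i : Fin I) (y : Profile I) (x : X)
    (θ : EuclideanSpace ℝ (Fin d)) : EReal :=
  if y i = 1 then ⊤ else ((-w i (opp i y) x θ : ℝ) : EReal)

/-- `∏ i, max {0, F(min_{y ∈ B} r_i(y, x, θ)) - F(max_{y ∈ B} l_i(y, x, θ))}`. For `B = ∅` the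
minimum is `+∞` and the maximum is `-∞`. -/
noncomputable def closedR (w : PayoffIndex I d X) (B : Finset (Profile I)) (x : X)
    (θ : EuclideanSpace ℝ (Fin d)) : ℝ :=
  ∏ i, max 0 (F (B.inf fun y => r w i y x θ) - F (B.sup fun y => l w i y x θ))

/-- `∑_{∅ ≠ B ⊆ A} (-1)^{|B| + 1} ∏ i, max {0, F(min_{y ∈ B} r_i) - F(max_{y ∈ B} l_i)}`. -/
noncomputable def closedL (w : PayoffIndex I d X) (A : Finset (Profile I)) (x : X)
    (θ : EuclideanSpace ℝ (Fin d)) : ℝ :=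
  ∑ B ∈ A.powerset with B.Nonempty, (-1 : ℝ) ^ (B.card + 1) * closedR w B x θ

end BinaryGame

/-!
The theorem rests on two facts.

*Closed forms.* Player `i`'s action in `y` is a best response exactly when `ξ_i` lies between
`l_i(y, x, θ)` and `r_i(y, x, θ)` (`mem_G_iff`). The event that all profiles in `A` are equilibria
is therefore a box, with sides from `max_{y ∈ A} l_i` to `min_{y ∈ A} r_i`, and independence
together with the logistic distribution function gives the product formula for `𝓡`
(`R_eq_closedR`). The event that some profile in `A` is an equilibrium is a finite union of the
events `y ∈ G`, whose intersections are these boxes, so inclusion–exclusion gives the formula for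
`𝓛` (`L_eq_closedL`).

*Sharpness.* A selection rule generates `φ` only if `φ(A) ≤ 𝓛(A)` for all `A`
(`IsSelectionRule.sum_integral_le_L`). Conversely, the set of equilibria is a random subset of a
finite set, and `exists_selection_of_capacity`, a finite form of Artstein's theorem, turns the
inequalities into a conditional law on each set of equilibria. The distributions that such
conditional laws generate form a compact convex set. If `φ` were outside it, some `c` would be
larger on average under `φ` than the average of its maximum over the random set; but by the layer
cake formula the inequalities for the super-level sets `{c > t}` exclude this
(`sum_mul_le_of_capacity`). The inequality for the full set of profiles says that an equilibrium
exists almost surely, so the event that there is none does not matter.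
-/

namespace BinaryGame

/-! ### The logistic law -/

lemma logisticDensity_eq_deriv_sigmoid (z : ℝ) :
    Real.exp (-z) / (1 + Real.exp (-z)) ^ 2 = Real.sigmoid z * (1 - Real.sigmoid z) := by
  rw [← Real.sigmoid_neg, ← Real.sigmoid_mul_rexp_neg, Real.sigmoid_def]
  have : 1 + Real.exp (-z) ≠ 0 := by positivity
  field_simp

/-- The logistic distribution function, bundled as a Stieltjes function. -/
noncomputable def sigmoidStieltjes : StieltjesFunction ℝ where
  toFun := Real.sigmoid
  mono' := Real.sigmoid_monotone
  right_continuous' _ := continuous_sigmoid.continuousWithinAt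

lemma sigmoidStieltjes_apply (z : ℝ) : sigmoidStieltjes z = Real.sigmoid z := rfl

lemma leftLim_sigmoidStieltjes (z : ℝ) :
    Function.leftLim sigmoidStieltjes z = Real.sigmoid z :=
  continuous_sigmoid.continuousWithinAt.leftLim_eq

/-- By the fundamental theorem of calculus, the measure with the logistic density is the
Stieltjes measure of the logistic distribution function. -/
lemma logistic_eq_measure_sigmoidStieltjes : logistic = sigmoidStieltjes.measure := by
  symm
  refine Measure.ext_of_Ioc _ _ fun a b hab => ?_
  have hcont : Continuous fun z => Real.sigmoid z * (1 - Real.sigmoid z) := by fun_prop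
  rw [StieltjesFunction.measure_Ioc, logistic, withDensity_apply _ measurableSet_Ioc]
  simp_rw [logisticDensity_eq_deriv_sigmoid]
  rw [← ofReal_integral_eq_lintegral_ofReal
      (hcont.integrableOn_Icc.mono_set Set.Ioc_subset_Icc_self)
      (Filter.Eventually.of_forall fun z => mul_nonneg (Real.sigmoid_nonneg z)
        (sub_nonneg.2 (Real.sigmoid_le_one z))),
    ← intervalIntegral.integral_of_le hab.le,
    intervalIntegral.integral_eq_sub_of_hasDerivAt (fun z _ => Real.hasDerivAt_sigmoid z)
      (hcont.intervalIntegrable a b)]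
  rfl

instance isProbabilityMeasure_logistic : IsProbabilityMeasure logistic := by
  rw [logistic_eq_measure_sigmoidStieltjes]
  exact sigmoidStieltjes.isProbabilityMeasure Real.tendsto_sigmoid_atBot
    Real.tendsto_sigmoid_atTop

instance isProbabilityMeasure_shockLaw (I : ℕ) : IsProbabilityMeasure (shockLaw I) := by
  unfold shockLaw; infer_instance

lemma F_bot : F ⊥ = 0 := by simp [F]

lemma F_top : F ⊤ = 1 := by simp [F]

lemma F_coe (z : ℝ) : F z = Real.sigmoid z := by
  simp [F, Real.sigmoid_def]

lemma F_nonneg (z : EReal) : 0 ≤ F z := by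
  induction z with
  | bot => simp [F_bot]
  | top => simp [F_top]
  | coe z => simpa [F_coe] using Real.sigmoid_nonneg z

lemma F_le_one (z : EReal) : F z ≤ 1 := by
  induction z with
  | bot => simp [F_bot]
  | top => simp [F_top]
  | coe z => simpa [F_coe] using Real.sigmoid_le_one z

/-- The logistic probability of the real points of an extended real interval. The maximum with `0`
accounts for the empty intervals, those with `b < a`. -/
lemma logistic_real_Icc (a b : EReal) :
    logistic.real ((↑) ⁻¹' Set.Icc a b : Set ℝ) = max 0 (F b - F a) := by
  have key : ∀ {s : Set ℝ} {c : ℝ}, sigmoidStieltjes.measure s = ENNReal.ofReal c →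
      logistic.real s = max 0 c := fun h => by
    rw [logistic_eq_measure_sigmoidStieltjes, measureReal_def, h, ENNReal.toReal_ofReal',
      max_comm]
  induction a with
  | top =>
    have : ((↑) ⁻¹' Set.Icc (⊤ : EReal) b : Set ℝ) = ∅ := by ext z; simp
    simp [this, F_top, F_le_one]
  | bot =>
    induction b with
    | bot =>
      have : ((↑) ⁻¹' Set.Icc (⊥ : EReal) ⊥ : Set ℝ) = ∅ := by ext z; simp
      rw [this]; simp
    | top => simp [F_bot, F_top]
    | coe b =>
      have : ((↑) ⁻¹' Set.Icc (⊥ : EReal) b : Set ℝ) = Set.Iic b := by ext z; simp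
      rw [this, F_bot, F_coe]
      exact key (sigmoidStieltjes.measure_Iic Real.tendsto_sigmoid_atBot b)
  | coe a =>
    induction b with
    | bot =>
      simp [F_bot, F_nonneg]
    | top =>
      have : ((↑) ⁻¹' Set.Icc (a : EReal) ⊤ : Set ℝ) = Set.Ici a := by ext z; simp
      rw [this, F_top, F_coe]
      refine key ?_
      rw [sigmoidStieltjes.measure_Ici Real.tendsto_sigmoid_atTop, leftLim_sigmoidStieltjes]
    | coe b =>
      have : ((↑) ⁻¹' Set.Icc (a : EReal) b : Set ℝ) = Set.Icc a b := by ext z; simp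
      rw [this, F_coe, F_coe]
      refine key ?_
      rw [sigmoidStieltjes.measure_Icc, leftLim_sigmoidStieltjes, sigmoidStieltjes_apply]

/-! ### Equilibrium events are boxes -/

variable {I d : ℕ} {X : Type*} (w : PayoffIndex I d X) (x : X) (θ : EuclideanSpace ℝ (Fin d))

lemma opp_update (i : Fin I) (y : Profile I) (a : Fin 2) :
    opp i (Function.update y i a) = opp i y := by
  ext j
  simp [opp, Function.update_of_ne j.2]

/-- Changing `i`'s own action leaves `w_i` unchanged, so `y_i` is a best response exactly when the
shock `ξ_i` lies on the correct side of `-w_i`. -/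
lemma mem_G_iff (ξ : Fin I → ℝ) (y : Profile I) :
    y ∈ G w ξ x θ ↔ ∀ i, (ξ i : EReal) ∈ Set.Icc (l w i y x θ) (r w i y x θ) := by
  refine forall_congr' fun i => ?_
  rcases (by omega : y i = 0 ∨ y i = 1) with h | h
  · simp [payoff, opp_update, Fin.forall_fin_two, l, r, h, -EReal.coe_neg]
    constructor <;> intro <;> linarith
  · simp [payoff, opp_update, Fin.forall_fin_two, l, r, h, -EReal.coe_neg]
    constructor <;> intro <;> linarith

/-- The event that all profiles in `A` are equilibria is a box: player `i`'s shock lies between the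
largest `l_i` and the smallest `r_i`. -/
lemma setOf_subset_G_eq_pi (A : Finset (Profile I)) :
    {ξ | (A : Set (Profile I)) ⊆ G w ξ x θ} = Set.univ.pi fun i =>
      (↑) ⁻¹' Set.Icc (A.sup fun y => l w i y x θ) (A.inf fun y => r w i y x θ) := by
  ext ξ
  simp only [Set.mem_ofPred_eq, Set.subset_def, Finset.mem_coe, mem_G_iff, Set.mem_univ_pi,
    Set.mem_preimage, Set.mem_Icc, Finset.sup_le_iff, Finset.le_inf_iff]
  grind

lemma R_eq_closedR (A : Finset (Profile I)) : R w A x θ = closedR w A x θ := by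
  rw [R, setOf_subset_G_eq_pi, shockLaw, measureReal_def, Measure.pi_pi, ENNReal.toReal_prod]
  exact Finset.prod_congr rfl fun i _ => logistic_real_Icc _ _

lemma measurableSet_mem_G (y : Profile I) : MeasurableSet {ξ | y ∈ G w ξ x θ} := by
  have h := setOf_subset_G_eq_pi w x θ {y}
  simp only [Finset.coe_singleton, Set.singleton_subset_iff] at h
  rw [h]
  exact MeasurableSet.univ_pi fun i => measurable_coe_real_ereal measurableSet_Icc

lemma setOf_G_inter_nonempty_eq_biUnion (A : Finset (Profile I)) :
    {ξ | (G w ξ x θ ∩ (A : Set (Profile I))).Nonempty} = ⋃ y ∈ A, {ξ | y ∈ G w ξ x θ} := by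
  ext ξ
  simp [Set.Nonempty, and_comm]

/-- Inclusion–exclusion for the union over `y ∈ A` of the events `y ∈ G(ξ | x; θ)`. -/
lemma L_eq_closedL (A : Finset (Profile I)) : L w A x θ = closedL w A x θ := by
  rw [L, setOf_G_inter_nonempty_eq_biUnion,
    measureReal_biUnion_eq_sum_powerset fun y _ => measurableSet_mem_G w x θ y, closedL]
  refine Finset.sum_congr rfl fun B _ => ?_
  rw [← R_eq_closedR, R]
  congr 2
  ext ξ
  simp [Set.subset_def]

end BinaryGame

/-! ### Artstein's theorem for random subsets of a finite set -/

section FiniteSelection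

variable {Y : Type*} [Fintype Y]

lemma setIntegral_Ico_indicator_Iio {a b c : ℝ} (hac : a ≤ c) (hcb : c ≤ b) :
    ∫ t in Set.Ico a b, (Set.Iio c).indicator (fun _ => (1 : ℝ)) t = c - a := by
  rw [integral_indicator_const _ measurableSet_Iio, measureReal_restrict_apply measurableSet_Iio,
    Set.inter_comm, Set.Ico_inter_Iio, min_eq_right hcb, Real.volume_real_Ico_of_le hac,
    smul_eq_mul, mul_one]

/-- The layer cake formula on a finite type: if all values of `v` lie in `[a, b]`, the masses of the
super-level sets `{v > t}` under `p` integrate over `[a, b)` to `∑ j, p j * (v j - a)`. -/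
lemma setIntegral_sum_mul_indicator_Iio {ι : Type*} [Fintype ι] (p v : ι → ℝ) {a b : ℝ}
    (ha : ∀ j, a ≤ v j) (hb : ∀ j, v j ≤ b) :
    IntegrableOn (fun t => ∑ j, p j * (Set.Iio (v j)).indicator (fun _ => (1 : ℝ)) t)
      (Set.Ico a b) ∧
    ∫ t in Set.Ico a b, ∑ j, p j * (Set.Iio (v j)).indicator (fun _ => (1 : ℝ)) t =
      ∑ j, p j * v j - (∑ j, p j) * a := by
  have hint : ∀ j, IntegrableOn (fun t => p j * (Set.Iio (v j)).indicator (fun _ => (1 : ℝ)) t)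
      (Set.Ico a b) := fun j =>
    ((integrable_const (1 : ℝ)).indicator measurableSet_Iio).const_mul (p j)
  refine ⟨integrable_finsetSum _ fun j _ => hint j, ?_⟩
  rw [integral_finsetSum _ fun j _ => hint j]
  simp_rw [integral_const_mul, fun j => setIntegral_Ico_indicator_Iio (ha j) (hb j), mul_sub,
    Finset.sum_sub_distrib, Finset.sum_mul]

/-- If `φ(A)` is at most the `q`-mass of the sets meeting `A`, for every `A`, then the expectation
of `c` under `φ` is at most the `q`-average of any upper bound `v K` for `c` on `K`. This is the
layer cake formula applied to the super-level sets `A = {c > t}`. -/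
lemma sum_mul_le_of_capacity [DecidableEq Y] {q : Finset Y → ℝ} {φ : Y → ℝ} (hq : ∀ K, 0 ≤ q K)
    (hqφ : ∑ K, q K = ∑ y, φ y)
    (h : ∀ A : Finset Y, ∑ y ∈ A, φ y ≤ ∑ K with ¬ Disjoint K A, q K)
    {c : Y → ℝ} {v : Finset Y → ℝ} (hv : ∀ K, ∀ y ∈ K, c y ≤ v K) :
    ∑ y, φ y * c y ≤ ∑ K, q K * v K := by
  obtain ⟨a, ha⟩ := ((Set.finite_range c).union (Set.finite_range v)).bddBelow
  obtain ⟨b, hb⟩ := ((Set.finite_range c).union (Set.finite_range v)).bddAbove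
  obtain ⟨hi₁, he₁⟩ := setIntegral_sum_mul_indicator_Iio φ c (a := a) (b := b)
    (fun y => ha (Or.inl ⟨y, rfl⟩)) (fun y => hb (Or.inl ⟨y, rfl⟩))
  obtain ⟨hi₂, he₂⟩ := setIntegral_sum_mul_indicator_Iio q v (a := a) (b := b)
    (fun y => ha (Or.inr ⟨y, rfl⟩)) (fun y => hb (Or.inr ⟨y, rfl⟩))
  have hle := integral_mono hi₁ hi₂ fun t => ?_
  · rw [he₁, he₂, hqφ] at hle
    linarith
  · calc ∑ y, φ y * (Set.Iio (c y)).indicator (fun _ => (1 : ℝ)) t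
        = ∑ y with t < c y, φ y := by
          simp [Set.indicator_apply, Finset.sum_filter]
      _ ≤ ∑ K with ¬ Disjoint K ({y | t < c y} : Finset Y), q K := h _
      _ ≤ ∑ K with t < v K, q K := by
          refine Finset.sum_le_sum_of_subset_of_nonneg (fun K hK => ?_) fun K _ _ => hq K
          simp only [Finset.mem_filter, Finset.mem_univ, true_and, Finset.not_disjoint_iff] at hK ⊢
          obtain ⟨y, hy, hty⟩ := hK
          exact hty.trans_le (hv K y hy)
      _ = ∑ K, q K * (Set.Iio (v K)).indicator (fun _ => (1 : ℝ)) t := by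
          simp [Set.indicator_apply, Finset.sum_filter]

/-- Artstein's theorem for finite sets: if a random subset of `Y` has distribution `q` and `φ(A)` is
at most the probability that it meets `A`, for every `A`, then `φ` is the distribution of a random
element of it, drawn with conditional law `σ K` when the subset is `K`. The law `σ ∅`
cannot be supported on `∅` and is unrestricted. -/
theorem exists_selection_of_capacity [DecidableEq Y] {q : Finset Y → ℝ} {φ : Y → ℝ}
    (hq : ∀ K, 0 ≤ q K) (hq_sum : ∑ K, q K = 1) (hφ_sum : ∑ y, φ y = 1)
    (h : ∀ A : Finset Y, ∑ y ∈ A, φ y ≤ ∑ K with ¬ Disjoint K A, q K) :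
    ∃ σ : Finset Y → Y → ℝ, (∀ K, σ K ∈ stdSimplex ℝ Y) ∧
      (∀ K : Finset Y, K.Nonempty → ∀ y ∉ K, σ K y = 0) ∧
      ∀ y, φ y = ∑ K, q K * σ K y := by
  -- `S K` is the set of conditional laws admissible at `K`. The distributions of random elements
  -- form the compact convex set `T '' Set.univ.pi S`, from which `φ` would be separated.
  let S : Finset Y → Set (Y → ℝ) := fun K =>
    stdSimplex ℝ Y ∩ {p | K.Nonempty → ∀ y ∉ K, p y = 0}
  have hSconv : ∀ K, Convex ℝ (S K) := fun K => by
    refine (convex_stdSimplex ℝ Y).inter fun p hp p' hp' a b _ _ _ hK y hy => ?_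
    simp [hp hK y hy, hp' hK y hy]
  have hScomp : ∀ K, IsCompact (S K) := fun K => by
    refine (isCompact_stdSimplex ℝ Y).inter_right ?_
    simp only [Set.ofPred_forall]
    exact isClosed_iInter fun _ => isClosed_iInter fun y => isClosed_iInter fun _ =>
      isClosed_eq (continuous_apply y) continuous_const
  let T : (Finset Y → Y → ℝ) →ₗ[ℝ] (Y → ℝ) := ∑ K, q K • LinearMap.proj K
  have hT : ∀ σ y, T σ y = ∑ K, q K * σ K y := fun σ y => by
    simp [T, LinearMap.sum_apply, Finset.sum_apply]
  have hTcont : Continuous T := LinearMap.continuous_of_finiteDimensional T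
  by_contra hne
  have hφ : φ ∉ T '' Set.univ.pi S := by
    rintro ⟨σ, hσ, rfl⟩
    exact hne ⟨σ, fun K => (hσ K trivial).1, fun K => (hσ K trivial).2, hT σ⟩
  obtain ⟨f, u, hfu, huf⟩ := geometric_hahn_banach_closed_point
    ((convex_pi fun K _ => hSconv K).linear_image T)
    ((isCompact_univ_pi hScomp).image hTcont).isClosed hφ
  set c : Y → ℝ := fun y => f (Pi.single y 1) with hc
  have hf : ∀ p : Y → ℝ, f p = ∑ y, p y * c y := fun p => by
    conv_lhs => rw [← Finset.univ_sum_single p]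
    rw [map_sum]
    refine Finset.sum_congr rfl fun y _ => ?_
    rw [hc, ← smul_eq_mul, ← map_smul, ← Pi.single_smul, smul_eq_mul, mul_one]
  have hY : Nonempty Y := by
    by_contra hY
    rw [not_nonempty_iff] at hY
    simp at hφ_sum
  -- The separating functional is maximized over the selections by putting all mass on a
  -- maximizer of `c` on each `K`.
  have hmax : ∀ K : Finset Y, ∃ m, (K.Nonempty → m ∈ K) ∧ ∀ y ∈ K, c y ≤ c m := fun K => by
    rcases K.eq_empty_or_nonempty with rfl | hK
    · exact ⟨hY.some, by simp, by simp⟩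
    · obtain ⟨m, hm, hmax⟩ := K.exists_max_image c hK
      exact ⟨m, fun _ => hm, hmax⟩
  choose m hmK hmc using hmax
  have hlt := hfu (T fun K => Pi.single (m K) 1) ⟨_, fun K _ =>
    ⟨single_mem_stdSimplex ℝ (m K), fun hK y hy =>
      Pi.single_eq_of_ne (M := fun _ => ℝ) (ne_of_mem_of_not_mem (hmK K hK) hy).symm 1⟩, rfl⟩
  have hval : f (T fun K => Pi.single (m K) 1) = ∑ K, q K * c (m K) := by
    simp [T, LinearMap.sum_apply, map_sum, hc]
  have hle := sum_mul_le_of_capacity hq (hq_sum.trans hφ_sum.symm) h hmc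
  rw [hval] at hlt
  rw [hf] at huf
  linarith

end FiniteSelection

namespace BinaryGame

variable {I d : ℕ} {X : Type*} (w : PayoffIndex I d X) (x : X) (θ : EuclideanSpace ℝ (Fin d))

/-! ### The sharp identified set -/

/-- Almost surely, a selection rule puts mass on `A` only if some profile in `A` is an equilibrium,
and this mass is at most `1`. -/
lemma IsSelectionRule.sum_integral_le_L {w : PayoffIndex I d X} {x : X}
    {θ : EuclideanSpace ℝ (Fin d)} {sel : (Fin I → ℝ) → Profile I → ℝ}
    (hsel : IsSelectionRule w x θ sel) (A : Finset (Profile I)) :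
    ∑ y ∈ A, ∫ ξ, sel ξ y ∂shockLaw I ≤ L w A x θ := by
  have hint : ∀ y, Integrable (fun ξ => sel ξ y) (shockLaw I) := fun y => by
    refine Integrable.of_bound (hsel.measurable y).aestronglyMeasurable 1 ?_
    filter_upwards [hsel.nonneg, hsel.sum_eq_one] with ξ h0 h1
    rw [Real.norm_of_nonneg (h0 y), ← h1]
    exact Finset.single_le_sum (fun y _ => h0 y) (Finset.mem_univ y)
  have hmeas : MeasurableSet {ξ | (G w ξ x θ ∩ (A : Set (Profile I))).Nonempty} := by
    rw [setOf_G_inter_nonempty_eq_biUnion]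
    exact A.measurableSet_biUnion fun y _ => measurableSet_mem_G w x θ y
  rw [← integral_finsetSum _ fun y _ => hint y, L, ← integral_indicator_one hmeas]
  refine integral_mono_ae (integrable_finsetSum _ fun y _ => hint y)
    ((integrable_const (1 : ℝ)).indicator hmeas) ?_
  filter_upwards [hsel.nonneg, hsel.sum_eq_one, hsel.equilibrium] with ξ h0 h1 h2
  by_cases hξ : (G w ξ x θ ∩ (A : Set (Profile I))).Nonempty
  · rw [Set.indicator_of_mem (by exact hξ), Pi.one_apply, ← h1]
    exact Finset.sum_le_univ_sum_of_nonneg h0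
  · rw [Set.indicator_of_notMem (by exact hξ)]
    refine (Finset.sum_eq_zero fun y hy => h2 y fun hyG => hξ ⟨y, hyG, hy⟩).le

open Classical in
/-- The set `G(ξ | x; θ)` of equilibria, as a `Finset`. -/
noncomputable def eqFinset (ξ : Fin I → ℝ) : Finset (Profile I) := {y | y ∈ G w ξ x θ}

lemma mem_eqFinset {ξ : Fin I → ℝ} {y : Profile I} : y ∈ eqFinset w x θ ξ ↔ y ∈ G w ξ x θ := by
  simp [eqFinset]

lemma measurableSet_eqFinset_mem (s : Set (Finset (Profile I))) :
    MeasurableSet {ξ | eqFinset w x θ ξ ∈ s} := by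
  have hK : ∀ K, MeasurableSet {ξ | eqFinset w x θ ξ = K} := fun K => by
    simp only [Finset.ext_iff, mem_eqFinset, Set.ofPred_forall]
    exact MeasurableSet.iInter fun y =>
      (measurableSet_mem_G w x θ y).iff (MeasurableSet.const _)
  have hs : {ξ | eqFinset w x θ ξ ∈ s} = ⋃ K ∈ s, {ξ | eqFinset w x θ ξ = K} := by
    ext ξ; simp
  rw [hs]
  exact MeasurableSet.biUnion s.to_countable fun K _ => hK K

lemma sum_measureReal_eqFinset_eq (p : Finset (Profile I) → Prop) [DecidablePred p] :
    ∑ K with p K, (shockLaw I).real {ξ | eqFinset w x θ ξ = K} =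
      (shockLaw I).real {ξ | p (eqFinset w x θ ξ)} := by
  rw [← measureReal_biUnion_finset]
  · congr 1
    ext ξ
    simp
  · intro K _ K' _ hKK'
    exact Set.disjoint_left.2 fun ξ h h' => hKK' (h.symm.trans h')
  · exact fun K _ => measurableSet_eqFinset_mem w x θ {K}

lemma integral_comp_eqFinset (g : Finset (Profile I) → ℝ) :
    ∫ ξ, g (eqFinset w x θ ξ) ∂shockLaw I =
      ∑ K, (shockLaw I).real {ξ | eqFinset w x θ ξ = K} * g K := by
  have hg : ∀ ξ, g (eqFinset w x θ ξ) =
      ∑ K, {ξ | eqFinset w x θ ξ = K}.indicator (fun _ => g K) ξ := fun ξ => by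
    simp [Set.indicator_apply]
  have hK : ∀ K, MeasurableSet {ξ | eqFinset w x θ ξ = K} := fun K =>
    measurableSet_eqFinset_mem w x θ {K}
  simp_rw [hg]
  rw [integral_finsetSum _ fun K _ => (integrable_const (g K)).indicator (hK K)]
  simp_rw [integral_indicator_const _ (hK _), smul_eq_mul]

/-- The inequalities `φ(A) ≤ 𝓛(A | x; θ)` suffice for a selection rule generating `φ`: the rule can
be taken to depend on the shocks through the set of equilibria only, which is a random subset of a
finite set. -/
lemma exists_isSelectionRule {φ : Profile I → ℝ} (hφ : ∑ y, φ y = 1)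
    (h : ∀ A : Finset (Profile I), ∑ y ∈ A, φ y ≤ L w A x θ) :
    ∃ sel : (Fin I → ℝ) → Profile I → ℝ, IsSelectionRule w x θ sel ∧
      ∀ y, φ y = ∫ ξ, sel ξ y ∂shockLaw I := by
  have hL : ∀ A, L w A x θ =
      ∑ K with ¬ Disjoint K A, (shockLaw I).real {ξ | eqFinset w x θ ξ = K} := fun A => by
    rw [sum_measureReal_eqFinset_eq, L]
    congr 1
    ext ξ
    simp [Finset.not_disjoint_iff, mem_eqFinset, Set.Nonempty]
  have hsum : ∑ K, (shockLaw I).real {ξ | eqFinset w x θ ξ = K} = 1 := by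
    simpa using sum_measureReal_eqFinset_eq w x θ fun _ => True
  obtain ⟨σ, hσ, hσ0, hφσ⟩ := exists_selection_of_capacity (fun K => measureReal_nonneg) hsum hφ
    fun A => (h A).trans (hL A).le
  -- The inequality for the full set of profiles says that an equilibrium exists almost surely.
  have hne : ∀ᵐ ξ ∂shockLaw I, (eqFinset w x θ ξ).Nonempty := by
    have h1 := h Finset.univ
    rw [hφ, hL, sum_measureReal_eqFinset_eq] at h1
    have hm := measurableSet_eqFinset_mem w x θ {K | K.Nonempty}
    have h2 := prob_le_one (μ := shockLaw I) (s := {ξ | (eqFinset w x θ ξ).Nonempty})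
    simp only [Finset.not_disjoint_iff_nonempty_inter, Finset.inter_univ] at h1
    refine (prob_compl_eq_zero_iff hm).2 (le_antisymm h2 ?_)
    rwa [measureReal_def, ← ENNReal.toReal_one,
      ENNReal.toReal_le_toReal ENNReal.one_ne_top (measure_ne_top _ _)] at h1
  refine ⟨fun ξ => σ (eqFinset w x θ ξ), ⟨fun y => ?_, .of_forall fun ξ => (hσ _).1,
    .of_forall fun ξ => (hσ _).2, ?_⟩, fun y => ?_⟩
  · exact fun s _ => measurableSet_eqFinset_mem w x θ ((fun K => σ K y) ⁻¹' s)
  · filter_upwards [hne] with ξ hξ y hy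
    exact hσ0 _ hξ y fun hmem => hy ((mem_eqFinset w x θ).1 hmem)
  · rw [integral_comp_eqFinset w x θ fun K => σ K y, hφσ y]

end BinaryGame

theorem mainTheorem4 {I d : ℕ} {X : Type*} [Finite X]
    (w : BinaryGame.PayoffIndex I d X) (Θ : Set (EuclideanSpace ℝ (Fin d)))
    (φ : X → BinaryGame.Profile I → ℝ)
    (hφ_nonneg : ∀ x y, 0 ≤ φ x y) (hφ_sum : ∀ x, ∑ y, φ x y = 1) :
    (∀ (A : Finset (BinaryGame.Profile I)) (x : X), ∀ θ ∈ Θ,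
      BinaryGame.R w A x θ = BinaryGame.closedR w A x θ ∧
      BinaryGame.L w A x θ = BinaryGame.closedL w A x θ) ∧
    BinaryGame.sharpSet w Θ φ =
      {θ | θ ∈ Θ ∧ ∀ p : X × Finset (BinaryGame.Profile I),
        ∑ y ∈ p.2, φ p.1 y ≤ BinaryGame.closedL w p.2 p.1 θ} ∧
    Finite (X × Finset (BinaryGame.Profile I)) := by
  refine ⟨fun A x θ _ => ⟨BinaryGame.R_eq_closedR w x θ A, BinaryGame.L_eq_closedL w x θ A⟩, ?_,
    inferInstance⟩
  ext θ
  refine and_congr_right fun _ => ⟨fun h p => ?_, fun h x => ?_⟩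
  · obtain ⟨sel, hsel, hφ⟩ := h p.1
    rw [← BinaryGame.L_eq_closedL]
    simp_rw [hφ]
    exact hsel.sum_integral_le_L p.2
  · exact BinaryGame.exists_isSelectionRule w x θ (hφ_sum x) fun A =>
      (h (x, A)).trans (BinaryGame.L_eq_closedL w x θ A).ge
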